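/- Let $\mathbb S=\{z\in\mathbb C:0<\operatorname{Re} z<1\}$ and let $A(\mathbb S)$ be the algebra of bounded continuous functions on $\overline{\mathbb S}$ that are analytic in $\mathbb S$. For a compatible couple $\bar A=(A_0,A_1)$ of complex Banach spaces, let $\mathcal F(\bar A)$ be the space of functions $f:\overline{\mathbb S}\to A_0+A_1$ such that $l\circ f\in A(\mathbb S)$ for every $l\in(A_0+A_1)^*$ and such that, for $j=0,1$, the function $t\mapsto f(j+it)$ takes values in $A_j$ and is bounded and continuous as a map $\mathbb R\to A_j$; put $\|f\|_{\mathcal F}=\max_{j=0,1}\sup_{t\in\mathbb R}\|f(j+it)\|_{A_j}$. For $0<\theta<1$ and $a\in A_0+A_1$ define (with $\inf\emptyset=+\infty$) $$\|a\|_\theta=\inf\{\|f\|_{\mathcal F}: f(\theta)=a\},\qquad \|a\|_{\delta'(\theta)}=\inf\{\|f\|_{\mathcal F}: f'(\theta)=a\},$$ $$\|a\|^{\delta'(\theta)}=\inf\{\|f\|_{\mathcal F}: f(\theta)=a,\ f'(\theta)=0\},$$ and $$\|a\|_{\delta(0)}=\limsup_{\theta\to0^+}\|a\|_\theta,\qquad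 \|a\|_{\delta'(0)}=\limsup_{\theta\to0^+}\frac{\|a\|_{\delta'(\theta)}}{\theta},\qquad \|a\|^{\delta'(0)}=\limsup_{\theta\to0^+}\|a\|^{\delta'(\theta)} .$$ Let $\bar A_{\delta(0)}$ and $\bar A_{\delta'(0)}$ be the sets of $a\in A_0+A_1$ for which $\|a\|_{\delta(0)}<\infty$, respectively $\|a\|_{\delta'(0)}<\infty$. **Theorem.** There is a universal constant $C>0$ with the following properties. Let $1\le p_0,p_1\le+\infty$, let $L^{p_0},L^{p_1}$ be the spaces of complex-valued functions over an arbitrary measure space, and let $D$ be a dense subset of $L^{p_0}\cap L^{p_1}$ (with the norm $\max(\|\cdot\|_{p_0},\|\cdot\|_{p_1})$). Then, for the couple $(L^{p_0},L^{p_1})$: 1. $\|d\|_{\delta(0)}=\|d\|_{p_0}$ for every $d\in D$. 2. The norms $\|\cdot\|^{\delta'(0)}$ and $\|\cdot\|_{p_0}$ are equivalent on $D$: $\;C^{-1}\|d\|_{p_0}\le\|d\|^{\delta'(0)}\le C\|d\|_{p_0}$ for every $d\in D$. 3. $(L^{p_0},L^{p_1})_{\delta(0)}\subseteq L^{p_0}$,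 and $\|f\|_{p_0}\le C\|f\|_{\delta(0)}$ for every $f\in(L^{p_0},L^{p_1})_{\delta(0)}$. 4. $(L^{p_0},L^{p_1})_{\delta'(0)}\subseteq L^{p_0}$, and $\|f\|_{p_0}\le C\|f\|_{\delta'(0)}$ for every $f\in(L^{p_0},L^{p_1})_{\delta'(0)}$. -/

import Mathlib

open MeasureTheory Filter Topology
open scoped ENNReal NNReal BoundedContinuousFunction

noncomputable section

/-- A compatible couple of complex Banach spaces `A₀`, `A₁`: both are included in a common vector
space `V`, and whenever `xₙ → x` in `A₀` and `xₙ → y` in `A₁` one has `x = y` in `V`. This last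
condition says that `A₀ + A₁`, with its usual norm, is Hausdorff. -/
structure BanachCouple (V A₀ A₁ : Type*) [AddCommGroup V] [Module ℂ V]
    [NormedAddCommGroup A₀] [NormedSpace ℂ A₀] [CompleteSpace A₀]
    [NormedAddCommGroup A₁] [NormedSpace ℂ A₁] [CompleteSpace A₁] where
  ι₀ : A₀ →ₗ[ℂ] V
  ι₁ : A₁ →ₗ[ℂ] V
  injective₀ : Function.Injective ι₀
  injective₁ : Function.Injective ι₁
  compatible : IsClosed {x : A₀ × A₁ | ι₀ x.1 = ι₁ x.2}

namespace BanachCouple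

variable {V A₀ A₁ : Type*} [AddCommGroup V] [Module ℂ V]
  [NormedAddCommGroup A₀] [NormedSpace ℂ A₀] [CompleteSpace A₀]
  [NormedAddCommGroup A₁] [NormedSpace ℂ A₁] [CompleteSpace A₁]
  (A : BanachCouple V A₀ A₁)

/-- The space `A₀ ∩ A₁`: an element is a pair `(x, y) ∈ A₀ × A₁` with `x = y` in `V`. As a subspace
of `A₀ × A₁` it carries the norm `max ‖x‖_{A₀} ‖x‖_{A₁}`. -/
def inter : Submodule ℂ (A₀ × A₁) :=
  LinearMap.eqLocus (A.ι₀ ∘ₗ LinearMap.fst ℂ A₀ A₁) (A.ι₁ ∘ₗ LinearMap.snd ℂ A₀ A₁)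

/-- The pairs `(x, y)` with `x + y = 0` in `V`, as a subspace of `A₀ ⊕ A₁` with the norm
`‖x‖_{A₀} + ‖y‖_{A₁}`. -/
def sumKer : Submodule ℂ (WithLp 1 (A₀ × A₁)) :=
  LinearMap.ker ((A.ι₀ ∘ₗ LinearMap.fst ℂ A₀ A₁ + A.ι₁ ∘ₗ LinearMap.snd ℂ A₀ A₁) ∘ₗ
    (WithLp.linearEquiv 1 ℂ (A₀ × A₁)).toLinearMap)

lemma mem_sumKer {x : WithLp 1 (A₀ × A₁)} :
    x ∈ A.sumKer ↔ A.ι₀ x.fst + A.ι₁ x.snd = 0 := Iff.rfl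

instance isClosed_sumKer : IsClosed (A.sumKer : Set (WithLp 1 (A₀ × A₁))) := by
  have hc : Continuous (fun x : WithLp 1 (A₀ × A₁) => ((x.fst, -x.snd) : A₀ × A₁)) := by
    fun_prop
  convert A.compatible.preimage hc using 1
  ext x
  simp [mem_sumKer, add_eq_zero_iff_eq_neg]

/-- The Banach space `A₀ + A₁`, realised as the quotient of `A₀ ⊕ A₁` by the pairs with sum zero.
Its quotient norm is `‖a‖ = inf {‖x‖_{A₀} + ‖y‖_{A₁} : a = x + y}`. -/
abbrev Sum : Type _ := WithLp 1 (A₀ × A₁) ⧸ A.sumKer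

/-- The inclusion of `A₀` in `A₀ + A₁`. -/
def incl₀ (x : A₀) : A.Sum := Submodule.Quotient.mk (WithLp.toLp 1 (x, 0))

/-- The inclusion of `A₁` in `A₀ + A₁`. -/
def incl₁ (y : A₁) : A.Sum := Submodule.Quotient.mk (WithLp.toLp 1 (0, y))

/-- Elements of `A₀ ∩ A₁` seen in `A₀ + A₁`. -/
def inclInter (d : A.inter) : A.Sum := A.incl₀ d.1.1

end BanachCouple

/-- The algebra `A(𝕊)` of the strip `𝕊 = {0 < Re z < 1}`: functions that are analytic in `𝕊`, and
bounded and continuous on its closure. Values outside the closed strip are irrelevant. -/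
def StripAlgebra (g : ℂ → ℂ) : Prop :=
  DiffContOnCl ℂ g (Complex.HadamardThreeLines.verticalStrip 0 1) ∧
    ∃ M : ℝ, ∀ z ∈ Complex.HadamardThreeLines.verticalClosedStrip 0 1, ‖g z‖ ≤ M

namespace BanachCouple

variable {V A₀ A₁ : Type*} [AddCommGroup V] [Module ℂ V]
  [NormedAddCommGroup A₀] [NormedSpace ℂ A₀] [CompleteSpace A₀]
  [NormedAddCommGroup A₁] [NormedSpace ℂ A₁] [CompleteSpace A₁]
  (A : BanachCouple V A₀ A₁)

/-- The elements of Calderon's space `𝓕(A₀, A₁)`, together with their boundary curves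
`t ↦ f (j + it)`, which are bounded and continuous with values in `A_j`. -/
structure CalderonSpace where
  toFun : ℂ → A.Sum
  analytic : ∀ l : StrongDual ℂ A.Sum, StripAlgebra fun z => l (toFun z)
  bdry₀ : ℝ →ᵇ A₀
  bdry₁ : ℝ →ᵇ A₁
  toFun_bdry₀ : ∀ t : ℝ, toFun (t * Complex.I) = A.incl₀ (bdry₀ t)
  toFun_bdry₁ : ∀ t : ℝ, toFun (1 + t * Complex.I) = A.incl₁ (bdry₁ t)

/-- The norm of `𝓕(A₀, A₁)`: the larger of `sup_t ‖f (it)‖_{A₀}` and `sup_t ‖f (1 + it)‖_{A₁}`. -/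
def CalderonSpace.enorm {A : BanachCouple V A₀ A₁} (F : A.CalderonSpace) : ℝ≥0∞ :=
  max ‖F.bdry₀‖ₑ ‖F.bdry₁‖ₑ

/-- The norm `‖a‖_θ` of the complex interpolation space `A_θ` (infinite if `a` is not in it). -/
def normTheta (θ : ℝ) (a : A.Sum) : ℝ≥0∞ :=
  ⨅ (F : A.CalderonSpace) (_ : F.toFun θ = a), F.enorm

/-- The norm `‖a‖_{δ'(θ)} = inf {‖F‖ : F'(θ) = a}` of the lower Schechter space. -/
def normLowerDelta' (θ : ℝ) (a : A.Sum) : ℝ≥0∞ :=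
  ⨅ (F : A.CalderonSpace) (_ : HasDerivAt F.toFun a (θ : ℂ)), F.enorm

/-- The norm `‖a‖^{δ'(θ)} = inf {‖F‖ : F(θ) = a, F'(θ) = 0}` of the upper Schechter space. -/
def normUpperDelta' (θ : ℝ) (a : A.Sum) : ℝ≥0∞ :=
  ⨅ (F : A.CalderonSpace) (_ : F.toFun θ = a ∧ HasDerivAt F.toFun 0 (θ : ℂ)), F.enorm

/-- `‖a‖_{δ(0)} = limsup_{θ → 0⁺} ‖a‖_θ`. -/
def normDeltaZero (a : A.Sum) : ℝ≥0∞ :=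
  limsup (fun θ : ℝ => A.normTheta θ a) (𝓝[>] 0)

/-- `‖a‖_{δ'(0)} = limsup_{θ → 0⁺} ‖a‖_{δ'(θ)} / θ`. -/
def normLowerDelta'Zero (a : A.Sum) : ℝ≥0∞ :=
  limsup (fun θ : ℝ => A.normLowerDelta' θ a / ENNReal.ofReal θ) (𝓝[>] 0)

/-- `‖a‖^{δ'(0)} = limsup_{θ → 0⁺} ‖a‖^{δ'(θ)}`. -/
def normUpperDelta'Zero (a : A.Sum) : ℝ≥0∞ :=
  limsup (fun θ : ℝ => A.normUpperDelta' θ a) (𝓝[>] 0)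

/-- The endpoint space `A_{δ(0)}`. -/
def spaceDeltaZero : Set A.Sum := {a | A.normDeltaZero a < ∞}

/-- The endpoint space `A_{δ'(0)}`. -/
def spaceLowerDelta'Zero : Set A.Sum := {a | A.normLowerDelta'Zero a < ∞}

end BanachCouple

/-- The inclusion of `L^p` in the space of classes of measurable functions. -/
def lpToAEEqFun {α : Type*} [MeasurableSpace α] (μ : Measure α) (p : ℝ≥0∞) [Fact (1 ≤ p)] :
    Lp ℂ p μ →ₗ[ℂ] (α →ₘ[μ] ℂ) where
  toFun f := f
  map_add' _ _ := rfl
  map_smul' _ _ := rfl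

/-- The compatible couple `(L^{p₀}(μ), L^{p₁}(μ))` of complex Lebesgue spaces. -/
def lpCouple {α : Type*} [MeasurableSpace α] (μ : Measure α) (p₀ p₁ : ℝ≥0∞)
    [Fact (1 ≤ p₀)] [Fact (1 ≤ p₁)] :
    BanachCouple (α →ₘ[μ] ℂ) (Lp ℂ p₀ μ) (Lp ℂ p₁ μ) where
  ι₀ := lpToAEEqFun μ p₀
  ι₁ := lpToAEEqFun μ p₁
  injective₀ := Subtype.val_injective
  injective₁ := Subtype.val_injective
  compatible := by
    refine IsSeqClosed.isClosed ?_
    intro x y hx hxy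
    have h₀ : TendstoInMeasure μ (fun n => ((x n).1 : α → ℂ)) atTop y.1 :=
      tendstoInMeasure_of_tendsto_Lp ((continuous_fst.tendsto y).comp hxy)
    have h₁ : TendstoInMeasure μ (fun n => ((x n).2 : α → ℂ)) atTop y.2 :=
      tendstoInMeasure_of_tendsto_Lp ((continuous_snd.tendsto y).comp hxy)
    have he : ∀ n, (((x n).1 : α →ₘ[μ] ℂ)) = ((x n).2 : α →ₘ[μ] ℂ) := hx
    have h₁' : TendstoInMeasure μ (fun n => ((x n).1 : α → ℂ)) atTop y.2 := by
      simpa only [he] using h₁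
    exact AEEqFun.ext (tendstoInMeasure_ae_unique h₀ h₁')

end

/-!
The constant is `C = 1`, and everything rests on the functional
`K(u, a) = inf {‖x‖_{A₀} + u ‖y‖_{A₁} : a = x + y}`, which is the norm of `a` in the sum space of the
couple whose second norm is multiplied by `u`.

For a functional `l` on `A₀ + A₁` with norm at most `1` on `A₀` and at most `u` on `A₁`, the three
lines theorem gives `|l(F(z))| ≤ u ^ (Re z) ‖F‖` for every `F ∈ 𝓕`. By Hahn–Banach,
`K(u, a) ≤ u ^ θ ‖a‖_θ`; with Cauchy's estimate on the disc of radius `θ` around `θ`, also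
`K(u, a) ≤ u ^ (2θ) ‖a‖_{δ'(θ)} / θ` for `u ≥ 1`. As `θ → 0` with `u` fixed, `K(u, a)` is bounded for
all `u ≥ 1` by `‖a‖_{δ(0)}` and by `‖a‖_{δ'(0)}`
(`BanachCouple.enorm_toRescale_le_normDeltaZero`,
`BanachCouple.enorm_toRescale_le_normLowerDelta'Zero`).

If `K(u, a) ≤ M` for all `u ≥ 1`, then `a` is a limit in `A₀ + A₁` of elements of `A₀` whose norms
tend to at most `M`. For Lebesgue spaces such a limit is also a limit almost everywhere along a
subsequence, and Fatou's lemma puts it in `L^{p₀}` with norm at most `M`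
(`exists_incl₀_eq_of_enorm_toRescale_le`). No assumption on the measure is needed, as duality of
Lebesgue spaces is not used.

The upper bounds for nonzero `d ∈ A₀ ∩ A₁` come from the single function
`F(z) = (1 - 2θ log r (z - θ) / (z + θ)) r ^ (z - θ) d` with `r = ‖d‖_{A₀} / ‖d‖_{A₁}`. It satisfies
`F(θ) = d` and `F'(θ) = 0`, and its norm tends to `‖d‖_{A₀}` as `θ → 0`
(`BanachCouple.normUpperDelta'Zero_inclInter_le`). Since `‖d‖_θ ≤ ‖d‖^{δ'(θ)}`, both limits are in
fact equal to `‖d‖_{p₀}`.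
-/

namespace BanachCouple

variable {V A₀ A₁ : Type*} [AddCommGroup V] [Module ℂ V]
  [NormedAddCommGroup A₀] [NormedSpace ℂ A₀] [CompleteSpace A₀]
  [NormedAddCommGroup A₁] [NormedSpace ℂ A₁] [CompleteSpace A₁]
  (A : BanachCouple V A₀ A₁)

/-! ### The `K`-functional as the norm of a rescaled couple -/

lemma mk_eq_mk_iff {w w' : WithLp 1 (A₀ × A₁)} :
    (Submodule.Quotient.mk w : A.Sum) = Submodule.Quotient.mk w' ↔
      A.ι₀ w.fst + A.ι₁ w.snd = A.ι₀ w'.fst + A.ι₁ w'.snd := by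
  rw [Submodule.Quotient.eq, mem_sumKer, ← sub_eq_zero (a := A.ι₀ w.fst + A.ι₁ w.snd)]
  simp only [WithLp.sub_fst, WithLp.sub_snd, map_sub]
  exact iff_of_eq (congrArg (· = 0) (by abel))

lemma incl₀_injective : Function.Injective A.incl₀ := fun x y h => by
  have := A.mk_eq_mk_iff.1 h
  exact A.injective₀ (by simpa using this)

lemma inclInter_eq_incl₁ (d : A.inter) : A.inclInter d = A.incl₁ d.1.2 := by
  have h : A.ι₀ d.1.1 = A.ι₁ d.1.2 := d.2
  exact A.mk_eq_mk_iff.2 (by simpa using h)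

lemma incl₀_smul (c : ℂ) (x : A₀) : A.incl₀ (c • x) = c • A.incl₀ x := by
  rw [incl₀, incl₀, ← Submodule.Quotient.mk_smul]
  exact A.mk_eq_mk_iff.2 (by simp)

lemma incl₁_smul (c : ℂ) (y : A₁) : A.incl₁ (c • y) = c • A.incl₁ y := by
  rw [incl₁, incl₁, ← Submodule.Quotient.mk_smul]
  exact A.mk_eq_mk_iff.2 (by simp)

lemma norm_incl₀_le (x : A₀) : ‖A.incl₀ x‖ ≤ ‖x‖ :=
  (Submodule.Quotient.norm_mk_le _ _).trans_eq (by simp)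

lemma norm_incl₁_le (y : A₁) : ‖A.incl₁ y‖ ≤ ‖y‖ :=
  (Submodule.Quotient.norm_mk_le _ _).trans_eq (by simp)

/-- The couple `(A₀, u • A₁)`: the second space is embedded by `u⁻¹ • ι₁`, so that an element `y` of
`A₁ ⊆ V` has norm `u ‖y‖`. The norm of its sum space is the functional
`K(u, a) = inf {‖x‖ + u ‖y‖ : a = x + y}` of `A`. -/
noncomputable def rescale {u : ℝ} (hu : 0 < u) : BanachCouple V A₀ A₁ where
  ι₀ := A.ι₀
  ι₁ := (u⁻¹ : ℂ) • A.ι₁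
  injective₀ := A.injective₀
  injective₁ := by
    have hu' : (u⁻¹ : ℂ) ≠ 0 := inv_ne_zero (Complex.ofReal_ne_zero.2 hu.ne')
    intro x y h
    exact A.injective₁ (smul_right_injective V hu' h)
  compatible := by
    have hc : Continuous (fun x : A₀ × A₁ => ((x.1, (u⁻¹ : ℂ) • x.2) : A₀ × A₁)) := by fun_prop
    convert A.compatible.preimage hc using 1
    ext x
    simp

/-- The identity of `A₀ + A₁`, as a map to the sum of the rescaled couple. -/
noncomputable def toRescale {u : ℝ} (hu : 0 < u) : A.Sum →L[ℂ] (A.rescale hu).Sum :=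
  A.sumKer.liftQL
    ((A.rescale hu).sumKer.mkQL ∘L
      (WithLp.prodContinuousLinearEquiv 1 ℂ A₀ A₁).symm.toContinuousLinearMap ∘L
      ((ContinuousLinearMap.id ℂ A₀).prodMap ((u : ℂ) • ContinuousLinearMap.id ℂ A₁)) ∘L
        (WithLp.prodContinuousLinearEquiv 1 ℂ A₀ A₁).toContinuousLinearMap) (by
    intro w hw
    have hu' : (u : ℂ) ≠ 0 := Complex.ofReal_ne_zero.2 hu.ne'
    have hw' := A.mem_sumKer.1 hw
    refine (Submodule.Quotient.mk_eq_zero _).2 ((A.rescale hu).mem_sumKer.2 ?_)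
    simpa [rescale, smul_smul, hu', -Complex.coe_smul] using hw')

lemma toRescale_mk {u : ℝ} (hu : 0 < u) (w : WithLp 1 (A₀ × A₁)) :
    A.toRescale hu (Submodule.Quotient.mk w) =
      Submodule.Quotient.mk (WithLp.toLp 1 (w.fst, (u : ℂ) • w.snd)) := rfl

lemma toRescale_incl₀ {u : ℝ} (hu : 0 < u) (x : A₀) :
    A.toRescale hu (A.incl₀ x) = (A.rescale hu).incl₀ x := by
  rw [incl₀, toRescale_mk]
  simp [incl₀]

lemma toRescale_incl₁ {u : ℝ} (hu : 0 < u) (y : A₁) :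
    A.toRescale hu (A.incl₁ y) = (A.rescale hu).incl₁ ((u : ℂ) • y) := by
  rw [incl₁, toRescale_mk]
  simp [incl₁]

/-- Elements with `K(u, a) < M` split as `a = x + y` with `‖x‖ ≤ M` and `u ‖y‖ ≤ M`. -/
lemma exists_decomposition {u : ℝ} (hu : 0 < u) {a : A.Sum} {M : ℝ}
    (h : ‖A.toRescale hu a‖ < M) :
    ∃ x y, a = Submodule.Quotient.mk (WithLp.toLp 1 (x, y)) ∧ ‖x‖ ≤ M ∧ u * ‖y‖ ≤ M := by
  obtain ⟨w, rfl⟩ := Submodule.Quotient.mk_surjective _ a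
  obtain ⟨m, hm, hmM⟩ := Submodule.Quotient.norm_mk_lt (A.toRescale hu (Submodule.Quotient.mk w))
    (sub_pos.2 h)
  have hu' : (u : ℂ) ≠ 0 := Complex.ofReal_ne_zero.2 hu.ne'
  rw [toRescale_mk, mk_eq_mk_iff] at hm
  rw [add_sub_cancel, WithLp.prod_norm_eq_of_L1] at hmM
  have h0 := norm_nonneg m.fst
  have h1 := norm_nonneg m.snd
  refine ⟨m.fst, (u⁻¹ : ℂ) • m.snd, A.mk_eq_mk_iff.2 ?_, by linarith, ?_⟩
  · simpa [rescale, smul_smul, hu', -Complex.coe_smul] using hm.symm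
  · rw [norm_smul, norm_inv, Complex.norm_real, Real.norm_of_nonneg hu.le,
      mul_inv_cancel_left₀ hu.ne']
    linarith

/-! ### Estimates for the `K`-functional -/

open Complex.HadamardThreeLines

namespace CalderonSpace

variable {A}

lemma enorm_eq_ofReal (F : A.CalderonSpace) :
    F.enorm = ENNReal.ofReal (max ‖F.bdry₀‖ ‖F.bdry₁‖) := by
  rw [ENNReal.ofReal_max, ofReal_norm, ofReal_norm, enorm]

/-- The three lines theorem: `K(u, F(z)) ≤ u ^ (Re z) ‖F‖`, in terms of a functional whose norms on
`A₀` and `A₁` are at most `1` and `u`. -/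
lemma norm_apply_le (F : A.CalderonSpace) (l : StrongDual ℂ A.Sum) {u : ℝ} (hu : 0 < u)
    (h₀ : ∀ x, ‖l (A.incl₀ x)‖ ≤ ‖x‖) (h₁ : ∀ y, ‖l (A.incl₁ y)‖ ≤ u * ‖y‖) {z : ℂ}
    (hz : z ∈ verticalClosedStrip 0 1) :
    ‖l (F.toFun z)‖ ≤ u ^ z.re * max ‖F.bdry₀‖ ‖F.bdry₁‖ := by
  set N := max ‖F.bdry₀‖ ‖F.bdry₁‖ with hN
  have hN0 : 0 ≤ N := (norm_nonneg _).trans (le_max_left _ _)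
  obtain ⟨hd, M, hM⟩ := F.analytic l
  have key := norm_le_interp_of_mem_verticalClosedStrip₀₁' (fun z => l (F.toFun z))
    (a := N) (b := u * N) hz hd ⟨M, by rintro _ ⟨w, hw, rfl⟩; exact hM w hw⟩ ?_ ?_
  · refine key.trans_eq ?_
    rw [Real.mul_rpow hu.le hN0, mul_left_comm,
      ← Real.rpow_add_of_nonneg hN0 (sub_nonneg.2 hz.2) hz.1, sub_add_cancel, Real.rpow_one]
  · intro w hw
    have hw' : w = w.im * Complex.I := by
      rw [Set.mem_preimage, Set.mem_singleton_iff] at hw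
      apply Complex.ext <;> simp [hw]
    rw [hw', F.toFun_bdry₀]
    exact (h₀ _).trans ((F.bdry₀.norm_coe_le_norm _).trans (le_max_left _ _))
  · intro w hw
    have hw' : w = 1 + w.im * Complex.I := by
      rw [Set.mem_preimage, Set.mem_singleton_iff] at hw
      apply Complex.ext <;> simp [hw]
    rw [hw', F.toFun_bdry₁]
    exact (h₁ _).trans (mul_le_mul_of_nonneg_left
      ((F.bdry₁.norm_coe_le_norm _).trans (le_max_right _ _)) hu.le)

end CalderonSpace

/-- Hahn–Banach: `K(u, a)` is at most the supremum of `|l(a)|` over the functionals `l` of norm at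
most `1` on `A₀` and at most `u` on `A₁`. -/
lemma norm_toRescale_le {u : ℝ} (hu : 0 < u) {a : A.Sum} {M : ℝ}
    (h : ∀ l : StrongDual ℂ A.Sum, (∀ x, ‖l (A.incl₀ x)‖ ≤ ‖x‖) →
      (∀ y, ‖l (A.incl₁ y)‖ ≤ u * ‖y‖) → ‖l a‖ ≤ M) :
    ‖A.toRescale hu a‖ ≤ M := by
  obtain ⟨g, hg, hga⟩ := exists_dual_vector'' ℂ (A.toRescale hu a)
  have hle : ∀ b, ‖g b‖ ≤ ‖b‖ := fun b => by
    simpa using g.le_of_opNorm_le hg b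
  have := h (g ∘L A.toRescale hu) (fun x => ?_) (fun y => ?_)
  · rw [ContinuousLinearMap.comp_apply, hga] at this
    simpa using this
  · rw [ContinuousLinearMap.comp_apply, toRescale_incl₀]
    exact (hle _).trans (norm_incl₀_le _ _)
  · rw [ContinuousLinearMap.comp_apply, toRescale_incl₁]
    refine (hle _).trans ((norm_incl₁_le _ _).trans_eq ?_)
    rw [norm_smul, Complex.norm_real, Real.norm_of_nonneg hu.le]

lemma enorm_toRescale_le_normTheta {u θ : ℝ} (hu : 0 < u) (hθ : θ ∈ Set.Icc (0 : ℝ) 1)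
    (a : A.Sum) :
    ‖A.toRescale hu a‖ₑ ≤ ENNReal.ofReal (u ^ θ) * A.normTheta θ a := by
  have hpos : 0 < u ^ θ := Real.rpow_pos_of_pos hu θ
  simp only [normTheta, ENNReal.mul_iInf_of_ne (ENNReal.ofReal_pos.2 hpos).ne'
    ENNReal.ofReal_ne_top]
  refine le_iInf₂ fun F hF => ?_
  rw [F.enorm_eq_ofReal, ← ENNReal.ofReal_mul hpos.le, ← ofReal_norm]
  refine ENNReal.ofReal_le_ofReal (A.norm_toRescale_le hu fun l h₀ h₁ => ?_)
  rw [← hF]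
  simpa using F.norm_apply_le l hu h₀ h₁ (z := θ) (by simpa [verticalClosedStrip] using hθ)

/-- Cauchy's estimate on the disc of radius `θ` around `θ`, the largest one contained in the
strip. -/
lemma enorm_toRescale_le_normLowerDelta' {u θ : ℝ} (hu : 1 ≤ u) (hθ : 0 < θ) (hθ' : θ ≤ 1 / 2)
    (a : A.Sum) :
    ‖A.toRescale (zero_lt_one.trans_le hu) a‖ₑ ≤
      ENNReal.ofReal (u ^ (2 * θ)) * (A.normLowerDelta' θ a / ENNReal.ofReal θ) := by
  have hu0 := zero_lt_one.trans_le hu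
  have hpos : 0 < u ^ (2 * θ) := Real.rpow_pos_of_pos hu0 _
  have hdiv : 0 < u ^ (2 * θ) / θ := div_pos hpos hθ
  rw [div_eq_mul_inv, mul_left_comm, ← div_eq_mul_inv, ← ENNReal.ofReal_div_of_pos hθ, mul_comm]
  simp only [normLowerDelta', ENNReal.mul_iInf_of_ne (ENNReal.ofReal_pos.2 hdiv).ne'
    ENNReal.ofReal_ne_top]
  refine le_iInf₂ fun F hF => ?_
  rw [F.enorm_eq_ofReal, ← ENNReal.ofReal_mul hdiv.le, ← ofReal_norm]
  refine ENNReal.ofReal_le_ofReal (A.norm_toRescale_le hu0 fun l h₀ h₁ => ?_)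
  have hd : HasDerivAt (fun z => l (F.toFun z)) (l a) (θ : ℂ) :=
    l.hasFDerivAt.comp_hasDerivAt _ hF
  have hre : ∀ z : ℂ, |z.re - θ| ≤ dist z θ := fun z => by
    simpa [dist_eq_norm] using Complex.abs_re_le_norm (z - θ)
  rw [← hd.deriv, div_mul_eq_mul_div]
  refine Complex.norm_deriv_le_of_forall_mem_sphere_norm_le hθ ((F.analytic l).1.mono ?_) ?_
  · intro z hz
    have := abs_lt.1 ((hre z).trans_lt hz)
    exact ⟨by linarith, by linarith⟩
  · intro z hz
    have := abs_le.1 ((hre z).trans_eq hz)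
    refine (F.norm_apply_le l hu0 h₀ h₁ ⟨by linarith, by linarith⟩).trans ?_
    exact mul_le_mul_of_nonneg_right (Real.rpow_le_rpow_of_exponent_le hu (by linarith))
      ((norm_nonneg _).trans (le_max_left _ _))

/-- The factor `u ^ (c θ)` disappears in the limit `θ → 0`. -/
lemma le_limsup_of_le_rpow_mul {f : ℝ → ℝ≥0∞} {k : ℝ≥0∞} {u : ℝ} (hu : 0 < u) (c : ℝ)
    (h : ∀ᶠ θ in 𝓝[>] (0 : ℝ), k ≤ ENNReal.ofReal (u ^ (c * θ)) * f θ) :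
    k ≤ limsup f (𝓝[>] 0) := by
  have ht : Tendsto (fun θ : ℝ => ENNReal.ofReal (u ^ (c * θ))) (𝓝[>] 0) (𝓝 1) := by
    have : Continuous fun θ : ℝ => u ^ (c * θ) :=
      continuous_const.rpow (by fun_prop) fun _ => Or.inl hu.ne'
    simpa using ENNReal.tendsto_ofReal ((this.tendsto 0).mono_left nhdsWithin_le_nhds)
  calc k = limsup (fun _ : ℝ => k) (𝓝[>] (0 : ℝ)) := (limsup_const k).symm
    _ ≤ limsup ((fun θ : ℝ => ENNReal.ofReal (u ^ (c * θ))) * f) (𝓝[>] 0) := limsup_le_limsup h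
    _ ≤ 1 * limsup f (𝓝[>] 0) := by
      rw [← ht.limsup_eq]
      exact ENNReal.limsup_mul_le' (Or.inl (by simp [ht.limsup_eq]))
        (Or.inl (by simp [ht.limsup_eq]))
    _ = _ := one_mul _

lemma enorm_toRescale_le_normDeltaZero {u : ℝ} (hu : 1 ≤ u) (a : A.Sum) :
    ‖A.toRescale (zero_lt_one.trans_le hu) a‖ₑ ≤ A.normDeltaZero a := by
  refine le_limsup_of_le_rpow_mul (zero_lt_one.trans_le hu) 1 ?_
  filter_upwards [Ioc_mem_nhdsGT (zero_lt_one' ℝ)] with θ hθ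
  simpa using A.enorm_toRescale_le_normTheta _ ⟨hθ.1.le, hθ.2⟩ a

lemma enorm_toRescale_le_normLowerDelta'Zero {u : ℝ} (hu : 1 ≤ u) (a : A.Sum) :
    ‖A.toRescale (zero_lt_one.trans_le hu) a‖ₑ ≤ A.normLowerDelta'Zero a := by
  refine le_limsup_of_le_rpow_mul (zero_lt_one.trans_le hu) 2 ?_
  filter_upwards [Ioc_mem_nhdsGT (show (0 : ℝ) < 1 / 2 by norm_num)] with θ hθ
  exact A.enorm_toRescale_le_normLowerDelta' hu hθ.1 hθ.2 a

lemma normTheta_le_normUpperDelta' (θ : ℝ) (a : A.Sum) :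
    A.normTheta θ a ≤ A.normUpperDelta' θ a :=
  le_iInf₂ fun F hF => iInf₂_le F hF.1

lemma normDeltaZero_le_normUpperDelta'Zero (a : A.Sum) :
    A.normDeltaZero a ≤ A.normUpperDelta'Zero a :=
  limsup_le_limsup (Eventually.of_forall fun θ => A.normTheta_le_normUpperDelta' θ a)

/-! ### Upper bounds on the intersection -/

/-- The element `z ↦ ψ(z) d` of `𝓕`, for `d ∈ A₀ ∩ A₁` and a bounded function `ψ` that is
differentiable within the closed strip at each of its points, which includes continuity up to the
boundary. -/
noncomputable def CalderonSpace.smulInter (d : A.inter) (ψ : ℂ → ℂ)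
    (hψ : DifferentiableOn ℂ ψ (verticalClosedStrip 0 1)) (M : ℝ)
    (hM : ∀ z ∈ verticalClosedStrip 0 1, ‖ψ z‖ ≤ M) : A.CalderonSpace where
  toFun z := ψ z • A.inclInter d
  analytic l := by
    have hcl : closure (verticalStrip 0 1) ⊆ verticalClosedStrip 0 1 :=
      closure_minimal (Set.preimage_mono Set.Ioo_subset_Icc_self)
        (isClosed_Icc.preimage Complex.continuous_re)
    simp only [map_smul, smul_eq_mul]
    refine ⟨((hψ.mono hcl).mul_const _).diffContOnCl, M * ‖l (A.inclInter d)‖, fun z hz => ?_⟩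
    rw [norm_mul]
    exact mul_le_mul_of_nonneg_right (hM z hz) (norm_nonneg _)
  bdry₀ := BoundedContinuousFunction.ofNormedAddCommGroup
    (fun t : ℝ => ψ (t * Complex.I) • d.1.1)
    ((hψ.continuousOn.comp_continuous (by fun_prop) fun t => by
      simp [verticalClosedStrip]).smul continuous_const) (M * ‖d.1.1‖) fun t => by
        rw [norm_smul]
        exact mul_le_mul_of_nonneg_right (hM _ (by simp [verticalClosedStrip])) (norm_nonneg _)
  bdry₁ := BoundedContinuousFunction.ofNormedAddCommGroup
    (fun t : ℝ => ψ (1 + t * Complex.I) • d.1.2)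
    ((hψ.continuousOn.comp_continuous (by fun_prop) fun t => by
      simp [verticalClosedStrip]).smul continuous_const) (M * ‖d.1.2‖) fun t => by
        rw [norm_smul]
        exact mul_le_mul_of_nonneg_right (hM _ (by simp [verticalClosedStrip])) (norm_nonneg _)
  toFun_bdry₀ t := (A.incl₀_smul _ _).symm
  toFun_bdry₁ t := by
    rw [inclInter_eq_incl₁]
    exact (A.incl₁_smul _ _).symm

/-- `ψ(z) = (1 - 2 θ log r (z - θ) / (z + θ)) r ^ (z - θ)`. The second factor balances the two
boundary norms. The first one cancels its derivative at `θ`, and differs from `1` by at most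
`2 θ |log r|`, because `|z - θ| ≤ |z + θ|` in the right half-plane. -/
noncomputable def stationaryFun (r θ : ℝ) (z : ℂ) : ℂ :=
  (1 - 2 * θ * Real.log r * ((z - θ) / (z + θ))) * Complex.exp ((z - θ) * Real.log r)

lemma add_ofReal_ne_zero {θ : ℝ} (hθ : 0 < θ) {z : ℂ} (hz : 0 ≤ z.re) : z + θ ≠ 0 := fun h => by
  have := congrArg Complex.re h
  simp at this
  linarith

lemma differentiableAt_stationaryFun (r : ℝ) {θ : ℝ} (hθ : 0 < θ) {z : ℂ} (hz : 0 ≤ z.re) :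
    DifferentiableAt ℂ (stationaryFun r θ) z := by
  have := add_ofReal_ne_zero hθ hz
  unfold stationaryFun
  fun_prop (disch := assumption)

lemma stationaryFun_self (r θ : ℝ) : stationaryFun r θ θ = 1 := by simp [stationaryFun]

lemma hasDerivAt_stationaryFun (r : ℝ) {θ : ℝ} (hθ : 0 < θ) :
    HasDerivAt (stationaryFun r θ) 0 (θ : ℂ) := by
  have hθ' : (θ : ℂ) ≠ 0 := Complex.ofReal_ne_zero.2 hθ.ne'
  have h2 : (θ : ℂ) + θ ≠ 0 := by rw [← two_mul]; exact mul_ne_zero two_ne_zero hθ'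
  have hq := ((hasDerivAt_id (θ : ℂ)).sub_const (θ : ℂ)).div
    ((hasDerivAt_id (θ : ℂ)).add_const (θ : ℂ)) h2
  have he := (((hasDerivAt_id (θ : ℂ)).sub_const (θ : ℂ)).mul_const (Real.log r : ℂ)).cexp
  have := ((hq.const_mul (2 * θ * Real.log r : ℂ)).const_sub 1).mul he
  refine this.congr_deriv ?_
  simp
  field_simp
  ring

lemma norm_stationaryFun_le (r : ℝ) {θ : ℝ} (hθ : 0 < θ) {z : ℂ} (hz : 0 ≤ z.re) :
    ‖stationaryFun r θ z‖ ≤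
      (1 + 2 * θ * |Real.log r|) * Real.exp ((z.re - θ) * Real.log r) := by
  have hB : ‖(z - θ) / (z + θ)‖ ≤ 1 := by
    rw [norm_div, div_le_one (norm_pos_iff.2 (add_ofReal_ne_zero hθ hz))]
    rw [← sq_le_sq₀ (norm_nonneg _) (norm_nonneg _), Complex.sq_norm, Complex.sq_norm,
      Complex.normSq_apply, Complex.normSq_apply]
    simp
    nlinarith
  rw [stationaryFun, norm_mul, Complex.norm_exp]
  refine mul_le_mul ?_ (le_of_eq ?_) (Real.exp_pos _).le (by positivity)
  · refine (norm_sub_le _ _).trans ?_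
    rw [norm_one, norm_mul]
    refine add_le_add_right ((mul_le_of_le_one_right (norm_nonneg _) hB).trans_eq ?_) 1
    rw [norm_mul, norm_mul, Complex.norm_real, Complex.norm_real, Real.norm_of_nonneg hθ.le]
    simp
  · rw [Complex.re_mul_ofReal, Complex.sub_re, Complex.ofReal_re]

lemma normUpperDelta'_inclInter_le (d : A.inter) {r θ : ℝ} (hr : 0 < r) (hθ : 0 < θ)
    (hrd : r * ‖d.1.2‖ ≤ ‖d.1.1‖) :
    A.normUpperDelta' θ (A.inclInter d) ≤ ENNReal.ofReal
      ((1 + 2 * θ * |Real.log r|) * Real.exp (-θ * Real.log r) * ‖d.1.1‖) := by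
  have hψ : DifferentiableOn ℂ (stationaryFun r θ) (verticalClosedStrip 0 1) := fun z hz =>
    (differentiableAt_stationaryFun r hθ hz.1).differentiableWithinAt
  have hM : ∀ z ∈ verticalClosedStrip 0 1, ‖stationaryFun r θ z‖ ≤
      (1 + 2 * θ * |Real.log r|) * Real.exp ((1 + θ) * |Real.log r|) := fun z hz => by
    refine (norm_stationaryFun_le r hθ hz.1).trans ?_
    refine mul_le_mul_of_nonneg_left (Real.exp_le_exp.2 ?_) (by positivity)
    refine (le_abs_self _).trans ?_
    rw [abs_mul]
    exact mul_le_mul_of_nonneg_right (abs_le.2 ⟨by linarith [hz.1], by linarith [hz.2]⟩)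
      (abs_nonneg _)
  refine (iInf₂_le (CalderonSpace.smulInter A d _ hψ _ hM) ⟨?h, ?h'⟩).trans ?_
  case h => simp [CalderonSpace.smulInter, stationaryFun_self]
  case h' =>
    simpa [CalderonSpace.smulInter] using (hasDerivAt_stationaryFun r hθ).smul_const (A.inclInter d)
  · rw [CalderonSpace.enorm_eq_ofReal]
    refine ENNReal.ofReal_le_ofReal (max_le ?_ ?_)
    · refine (BoundedContinuousFunction.norm_le (by positivity)).2 fun t => ?_
      change ‖stationaryFun r θ (t * Complex.I) • d.1.1‖ ≤ _
      rw [norm_smul]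
      gcongr
      simpa using norm_stationaryFun_le r hθ (z := t * Complex.I) (by simp)
    · refine (BoundedContinuousFunction.norm_le (by positivity)).2 fun t => ?_
      change ‖stationaryFun r θ (1 + t * Complex.I) • d.1.2‖ ≤ _
      rw [norm_smul]
      have h := norm_stationaryFun_le r hθ (z := 1 + t * Complex.I) (by simp)
      have hexp : Real.exp ((1 - θ) * Real.log r) = Real.exp (-θ * Real.log r) * r := by
        rw [← Real.exp_log hr, ← Real.exp_add, Real.log_exp]
        ring_nf
      have hre : (1 + t * Complex.I : ℂ).re = 1 := by simp
      rw [hre, hexp] at h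
      calc _ ≤ (1 + 2 * θ * |Real.log r|) * (Real.exp (-θ * Real.log r) * r) * ‖d.1.2‖ := by gcongr
        _ = (1 + 2 * θ * |Real.log r|) * Real.exp (-θ * Real.log r) * (r * ‖d.1.2‖) := by ring
        _ ≤ _ := by gcongr

lemma normUpperDelta'Zero_inclInter_le (d : A.inter) :
    A.normUpperDelta'Zero (A.inclInter d) ≤ ‖d.1.1‖ₑ := by
  obtain ⟨r, hr, hrd⟩ : ∃ r : ℝ, 0 < r ∧ r * ‖d.1.2‖ ≤ ‖d.1.1‖ := by
    rcases eq_or_ne d.1.2 0 with h1 | h1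
    · exact ⟨1, one_pos, by simp [h1]⟩
    · have h0 : d.1.1 ≠ 0 := fun h0 => h1 (A.injective₁ (by
        have h : A.ι₀ d.1.1 = A.ι₁ d.1.2 := d.2
        rw [← h, h0, map_zero, map_zero]))
      exact ⟨‖d.1.1‖ / ‖d.1.2‖, div_pos (norm_pos_iff.2 h0) (norm_pos_iff.2 h1),
        (div_mul_cancel₀ _ (norm_ne_zero_iff.2 h1)).le⟩
  have hc : Continuous fun θ : ℝ =>
      (1 + 2 * θ * |Real.log r|) * Real.exp (-θ * Real.log r) * ‖d.1.1‖ := by fun_prop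
  have ht : Tendsto (fun θ : ℝ => ENNReal.ofReal
      ((1 + 2 * θ * |Real.log r|) * Real.exp (-θ * Real.log r) * ‖d.1.1‖)) (𝓝[>] 0)
      (𝓝 ‖d.1.1‖ₑ) := by
    rw [← ofReal_norm]
    simpa using ENNReal.tendsto_ofReal ((hc.tendsto 0).mono_left nhdsWithin_le_nhds)
  rw [← ht.limsup_eq]
  refine limsup_le_limsup ?_
  filter_upwards [self_mem_nhdsWithin] with θ hθ
  exact A.normUpperDelta'_inclInter_le d hr hθ hrd

end BanachCouple

/-! ### Closedness of the unit ball of `L^p₀` in `L^p₀ + L^p₁` -/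

section Lebesgue

variable {α : Type*} [MeasurableSpace α] {μ : Measure α} {p₀ p₁ : ℝ≥0∞}
  [Fact (1 ≤ p₀)] [Fact (1 ≤ p₁)]

/-- If `K(u, a) ≤ M` for all `u`, then `a` is the limit in measure of functions `xₙ` with
`limsup ‖xₙ‖_{p₀} ≤ M`, and Fatou's lemma gives `‖a‖_{p₀} ≤ M`. -/
lemma exists_incl₀_eq_of_enorm_toRescale_le {a : (lpCouple μ p₀ p₁).Sum} {M : ℝ≥0∞} (hM : M ≠ ∞)
    (h : ∀ (u : ℝ) (hu : 1 ≤ u),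
      ‖(lpCouple μ p₀ p₁).toRescale (zero_lt_one.trans_le hu) a‖ₑ ≤ M) :
    ∃ g : Lp ℂ p₀ μ, (lpCouple μ p₀ p₁).incl₀ g = a ∧ ‖g‖ₑ ≤ M := by
  lift M to ℝ≥0 using hM
  have hdec : ∀ n : ℕ, ∃ (x : Lp ℂ p₀ μ) (y : Lp ℂ p₁ μ),
      a = Submodule.Quotient.mk (WithLp.toLp 1 (x, y)) ∧
        ‖x‖ ≤ M + 1 / ((n : ℝ) + 1) ∧ ‖y‖ ≤ (M + 1) * (1 / ((n : ℝ) + 1)) := fun n => by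
    have hn : (0 : ℝ) < n + 1 := by positivity
    have hn1 : (1 : ℝ) ≤ n + 1 := by simp
    have hK : ‖(lpCouple μ p₀ p₁).toRescale (zero_lt_one.trans_le hn1) a‖ ≤ M := by
      exact NNReal.coe_le_coe.2 (enorm_le_coe.1 (h _ hn1))
    obtain ⟨x, y, ha, hx, hy⟩ := (lpCouple μ p₀ p₁).exists_decomposition _
      (hK.trans_lt (lt_add_of_pos_right _ (one_div_pos.2 hn)))
    refine ⟨x, y, ha, hx, ?_⟩
    rw [mul_one_div, le_div_iff₀ hn, mul_comm]
    refine hy.trans ?_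
    gcongr
    exact (div_le_one hn).2 hn1
  choose x y ha hx hy using hdec
  have hlim : Tendsto (fun n : ℕ => 1 / ((n : ℝ) + 1)) atTop (𝓝 0) :=
    tendsto_one_div_add_atTop_nhds_zero_nat
  have hy0 : Tendsto y atTop (𝓝 0) :=
    squeeze_zero_norm hy (by simpa using hlim.const_mul ((M : ℝ) + 1))
  -- `x n - x 0 = y 0 - y n`, so a subsequence of `x n` converges almost everywhere to `x 0 + y 0`.
  obtain ⟨ns, hns, hae⟩ := (tendstoInMeasure_of_tendsto_Lp hy0).exists_seq_tendsto_ae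
  have hV : ∀ n, (x n : α →ₘ[μ] ℂ) + y n = (x 0 : α →ₘ[μ] ℂ) + y 0 := fun n =>
    (lpCouple μ p₀ p₁).mk_eq_mk_iff.1 ((ha n).symm.trans (ha 0))
  set b : α →ₘ[μ] ℂ := (x 0 : α →ₘ[μ] ℂ) + y 0 with hb
  have hVae : ∀ n, ∀ᵐ s ∂μ, x n s = b s - y n s := fun n => by
    filter_upwards [AEEqFun.coeFn_add (x n : α →ₘ[μ] ℂ) (y n)] with s hs
    rw [hV n] at hs
    simp [hs]
  have hconv : ∀ᵐ s ∂μ, Tendsto (fun i => x (ns i) s) atTop (𝓝 (b s)) := by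
    filter_upwards [hae, ae_all_iff.2 hVae, Lp.coeFn_zero ℂ p₁ μ] with s hs hs' hs0
    simp only [hs']
    rw [hs0] at hs
    simpa using hs.const_sub (b s)
  have hnorm : eLpNorm b p₀ μ ≤ M := by
    refine (Lp.eLpNorm_lim_le_liminf_eLpNorm (fun i => Lp.aestronglyMeasurable (x (ns i)))
      b hconv).trans ?_
    have ht : Tendsto (fun i => ENNReal.ofReal (M + 1 / ((ns i : ℝ) + 1))) atTop (𝓝 M) := by
      simpa using ENNReal.tendsto_ofReal ((hlim.comp hns.tendsto_atTop).const_add (M : ℝ))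
    rw [← ht.liminf_eq]
    refine liminf_le_liminf (Eventually.of_forall fun i => ?_)
    rw [← Lp.enorm_def, ← ofReal_norm]
    exact ENNReal.ofReal_le_ofReal (hx _)
  refine ⟨⟨b, Lp.mem_Lp_iff_eLpNorm_lt_top.2 (hnorm.trans_lt ENNReal.coe_lt_top)⟩, ?_, ?_⟩
  · rw [ha 0]
    exact (lpCouple μ p₀ p₁).mk_eq_mk_iff.2 (add_zero b)
  · rw [Lp.enorm_def]
    exact hnorm

lemma exists_incl₀_eq_of_mem_spaceDeltaZero {a : (lpCouple μ p₀ p₁).Sum}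
    (ha : a ∈ (lpCouple μ p₀ p₁).spaceDeltaZero) :
    ∃ g : Lp ℂ p₀ μ, (lpCouple μ p₀ p₁).incl₀ g = a ∧
      ‖g‖ₑ ≤ (lpCouple μ p₀ p₁).normDeltaZero a :=
  exists_incl₀_eq_of_enorm_toRescale_le ha.ne fun _ hu =>
    (lpCouple μ p₀ p₁).enorm_toRescale_le_normDeltaZero hu a

lemma normDeltaZero_inclInter (d : (lpCouple μ p₀ p₁).inter) :
    (lpCouple μ p₀ p₁).normDeltaZero ((lpCouple μ p₀ p₁).inclInter d) = ‖d.1.1‖ₑ := by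
  have hle : (lpCouple μ p₀ p₁).normDeltaZero ((lpCouple μ p₀ p₁).inclInter d) ≤ ‖d.1.1‖ₑ :=
    ((lpCouple μ p₀ p₁).normDeltaZero_le_normUpperDelta'Zero _).trans
      ((lpCouple μ p₀ p₁).normUpperDelta'Zero_inclInter_le d)
  obtain ⟨g, hg, hgn⟩ := exists_incl₀_eq_of_mem_spaceDeltaZero
    (hle.trans_lt (enorm_lt_top (x := d.1.1)))
  obtain rfl := (lpCouple μ p₀ p₁).incl₀_injective hg
  exact hle.antisymm hgn

end Lebesgue

theorem mainTheorem10 :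
    ∃ C : ℝ≥0, 0 < C ∧
      ∀ (α : Type*) [MeasurableSpace α] (μ : Measure α) (p₀ p₁ : ℝ≥0∞)
        [Fact (1 ≤ p₀)] [Fact (1 ≤ p₁)],
        (∀ D : Set (lpCouple μ p₀ p₁).inter, Dense D → ∀ d ∈ D,
          (lpCouple μ p₀ p₁).normDeltaZero ((lpCouple μ p₀ p₁).inclInter d) = ‖d.1.1‖ₑ ∧
          (lpCouple μ p₀ p₁).normUpperDelta'Zero ((lpCouple μ p₀ p₁).inclInter d)
            ≤ C * ‖d.1.1‖ₑ ∧
          ‖d.1.1‖ₑ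
            ≤ C * (lpCouple μ p₀ p₁).normUpperDelta'Zero ((lpCouple μ p₀ p₁).inclInter d)) ∧
        (∀ f ∈ (lpCouple μ p₀ p₁).spaceDeltaZero, ∃ g : Lp ℂ p₀ μ,
          (lpCouple μ p₀ p₁).incl₀ g = f ∧
          ‖g‖ₑ ≤ C * (lpCouple μ p₀ p₁).normDeltaZero f) ∧
        (∀ f ∈ (lpCouple μ p₀ p₁).spaceLowerDelta'Zero, ∃ g : Lp ℂ p₀ μ,
          (lpCouple μ p₀ p₁).incl₀ g = f ∧
          ‖g‖ₑ ≤ C * (lpCouple μ p₀ p₁).normLowerDelta'Zero f) := by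
  refine ⟨1, one_pos, fun α _ μ p₀ p₁ _ _ => ?_⟩
  simp only [ENNReal.coe_one, one_mul]
  refine ⟨fun D _ d _ => ⟨normDeltaZero_inclInter d,
    (lpCouple μ p₀ p₁).normUpperDelta'Zero_inclInter_le d, ?_⟩,
    fun f hf => exists_incl₀_eq_of_mem_spaceDeltaZero hf,
    fun f hf => exists_incl₀_eq_of_enorm_toRescale_le hf.ne fun _ hu =>
      (lpCouple μ p₀ p₁).enorm_toRescale_le_normLowerDelta'Zero hu f⟩
  rw [← normDeltaZero_inclInter d]
  exact (lpCouple μ p₀ p₁).normDeltaZero_le_normUpperDelta'Zero _
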